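/- For $\gamma>0$ let $\mathbb{H}_\gamma=\{(z_1,z_2)\in\mathbb{C}^2 : |z_1|^{\gamma}<|z_2|<1\}$, and let $A^2(\mathbb{H}_\gamma)$ be the space of holomorphic functions on $\mathbb{H}_\gamma$ that are square-integrable with respect to Lebesgue measure $dV$ on $\mathbb{C}^2$. The Bergman kernel of $\mathbb{H}_\gamma$ is the unique function $\mathbb{B}_\gamma:\mathbb{H}_\gamma\times\mathbb{H}_\gamma\to\mathbb{C}$ such that $\mathbb{B}_\gamma(\cdot,w)\in A^2(\mathbb{H}_\gamma)$ for every $w\in\mathbb{H}_\gamma$, $\mathbb{B}_\gamma(w,z)=\overline{\mathbb{B}_\gamma(z,w)}$ for all $z,w\in\mathbb{H}_\gamma$, and $$f(z)=\int_{\mathbb{H}_\gamma}\mathbb{B}_\gamma(z,w)\,f(w)\,dV(w)\qquad\text{for all } f\in A^2(\mathbb{H}_\gamma),\ z\in\mathbb{H}_\gamma .$$ Theorem. Let $k$ be a positive integer. The Bergman kernel of $\mathbb{H}_{1/k}$ is given, for all $z=(z_1,z_2)$ and $w=(w_1,w_2)$ in $\mathbb{H}_{1/k}$, by $$\mathbb{B}_{1/k}(z,w)=\frac{t^k}{\pi^2(1-t)^2(t^k-s)^2},\qquad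 s=z_1\bar w_1,\quad t=z_2\bar w_2 .$$ -/

import Mathlib

open MeasureTheory ComplexConjugate

/-- The generalized Hartogs triangle of exponent `γ` in `ℂ²`:
`{(z₁, z₂) : |z₁|^γ < |z₂| < 1}`. -/
def hartogsTriangle (γ : ℝ) : Set (ℂ × ℂ) :=
  {z | ‖z.1‖ ^ γ < ‖z.2‖ ∧ ‖z.2‖ < 1}

/-- The Bergman space `A²(Ω)` of a domain `Ω ⊆ ℂ²`: the functions that are holomorphic on `Ω` and
square-integrable on `Ω` with respect to Lebesgue measure (values off `Ω` play no role). -/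
def bergmanSpace (Ω : Set (ℂ × ℂ)) : Set (ℂ × ℂ → ℂ) :=
  {f | DifferentiableOn ℂ f Ω ∧ MemLp f 2 (volume.restrict Ω)}

/-- `K` is the Bergman kernel of `Ω ⊆ ℂ²`: each `K(·, w)` with `w ∈ Ω` lies in the Bergman space,
`K` is conjugate symmetric on `Ω × Ω`, and `K` reproduces the functions of the Bergman space.
For an open `Ω` these properties determine `K` on `Ω × Ω`. -/
structure IsBergmanKernel (Ω : Set (ℂ × ℂ)) (K : ℂ × ℂ → ℂ × ℂ → ℂ) : Prop where
  mem_bergmanSpace : ∀ w ∈ Ω, (fun z => K z w) ∈ bergmanSpace Ω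
  conj_symm : ∀ z ∈ Ω, ∀ w ∈ Ω, K w z = conj (K z w)
  reproducing : ∀ f ∈ bergmanSpace Ω, ∀ z ∈ Ω, f z = ∫ w in Ω, K z w * f w

/-!
The map `(u, v) ↦ (u vᵏ, v)` carries the product of the unit disc and the punctured unit disc
biholomorphically onto the Hartogs triangle of exponent `1 / k`, which is the domain
`|z₁| < |z₂|ᵏ < 1`. Its complex Jacobian is `vᵏ`, so `f ↦ vᵏ f(u vᵏ, v)` is an isometry of Bergman
spaces (`map_hartogsMap_withDensity`, `memLp_hartogsTriangle_iff`), and the kernel of the Hartogs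
triangle is the pull-back of the product of two disc kernels (`hartogsKernel_hartogsMap`).

For the unit disc the reproducing formula is proved in polar coordinates
(`integral_discKernel_mul`): on each circle Cauchy's formula for the derivative evaluates the
angular integral, and the radial integrand is then the derivative of `r ↦ r² h(r² z)`.
Square-integrable holomorphic functions on the punctured disc extend across the puncture, since the
sub-mean value inequality makes them `o(1 / |v|)` there; so the same kernel reproduces them
(`setIntegral_puncturedDisc_discKernel_mul`). Fubini's theorem gives the formula on the product
(`setIntegral_puncturedBidisc_mul`). It needs every slice in the punctured variable to be
square-integrable (`memLp_slice_snd`).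

Uniqueness is the usual symmetry argument (`IsBergmanKernel.eqOn`).
-/

section

open Set Metric Filter Topology
open scoped ENNReal

/-! ### The unit disc -/

/-- The Bergman kernel `1 / (π (1 - z w̄)²)` of the unit disc. -/
noncomputable def discKernel (z w : ℂ) : ℂ := 1 / (Real.pi * (1 - z * conj w) ^ 2)

theorem norm_mul_conj_lt_one {z w : ℂ} (hz : ‖z‖ < 1) (hw : ‖w‖ < 1) : ‖z * conj w‖ < 1 := by
  rw [norm_mul, RCLike.norm_conj]
  exact mul_lt_one_of_nonneg_of_lt_one_left (norm_nonneg _) hz hw.le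

theorem one_sub_ne_zero_of_norm_lt_one {a : ℂ} (ha : ‖a‖ < 1) : 1 - a ≠ 0 := by
  intro h
  rw [← sub_eq_zero.mp h, norm_one] at ha
  exact lt_irrefl _ ha

theorem continuousOn_discKernel {z : ℂ} (hz : z ∈ ball (0 : ℂ) 1) :
    ContinuousOn (discKernel z) (ball 0 1) := by
  refine continuousOn_const.div (by fun_prop) fun w hw => ?_
  exact mul_ne_zero (by simp [Real.pi_ne_zero]) (pow_ne_zero _ (one_sub_ne_zero_of_norm_lt_one
    (norm_mul_conj_lt_one (mem_ball_zero_iff.mp hz) (mem_ball_zero_iff.mp hw))))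

theorem norm_discKernel_le {z w : ℂ} (hz : z ∈ ball (0 : ℂ) 1) (hw : w ∈ ball (0 : ℂ) 1) :
    ‖discKernel z w‖ ≤ 1 / (Real.pi * (1 - ‖z‖) ^ 2) := by
  rw [mem_ball_zero_iff] at hz hw
  have h : 1 - ‖z‖ ≤ ‖1 - z * conj w‖ := by
    have h1 := norm_sub_norm_le (1 : ℂ) (z * conj w)
    rw [norm_one, norm_mul, RCLike.norm_conj] at h1
    nlinarith [norm_nonneg z]
  have h0 : 0 < 1 - ‖z‖ := by linarith
  rw [discKernel, norm_div, norm_one, norm_mul, norm_pow, Complex.norm_real, Real.norm_eq_abs,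
    abs_of_pos Real.pi_pos]
  gcongr

/-- Integration over the unit disc in polar coordinates, as an iterated integral. -/
theorem integral_unitBall_eq_integral_circleMap {f : ℂ → ℂ} (hc : ContinuousOn f (ball 0 1))
    (hi : IntegrableOn f (ball 0 1)) :
    ∫ w in ball (0 : ℂ) 1, f w =
      ∫ r in (0 : ℝ)..1, r • ∫ θ in (0 : ℝ)..2 * Real.pi, f (circleMap 0 r θ) := by
  set T : Set (ℝ × ℝ) := Ioo 0 1 ×ˢ Ioo (-Real.pi) Real.pi with hT
  have hTm : MeasurableSet T := measurableSet_Ioo.prod measurableSet_Ioo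
  have hpolar (p : ℝ × ℝ) : Complex.polarCoord.symm p = circleMap 0 p.1 p.2 := by
    simp [circleMap, Complex.exp_mul_I]
  have hTt : polarCoord.target ∩ T = T := by
    refine inter_eq_right.mpr fun p hp => ?_
    rw [polarCoord_target]
    exact ⟨hp.1.1, hp.2⟩
  have hmem {p : ℝ × ℝ} (hp : p ∈ polarCoord.target) :
      circleMap 0 p.1 p.2 ∈ ball (0 : ℂ) 1 ↔ p ∈ T := by
    rw [polarCoord_target] at hp
    have h1 : (0 : ℝ) < p.1 := hp.1
    rw [mem_ball_zero_iff, norm_circleMap_zero, abs_of_pos h1]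
    exact ⟨fun h => ⟨⟨h1, h⟩, hp.2⟩, fun h => h.1.2⟩
  have hint : ∫ w in ball (0 : ℂ) 1, f w = ∫ p in T, p.1 • f (circleMap 0 p.1 p.2) := by
    rw [← integral_indicator measurableSet_ball, ← Complex.integral_comp_polarCoord_symm,
      ← hTt, ← setIntegral_indicator hTm]
    refine setIntegral_congr_fun polarCoord.open_target.measurableSet fun p hp => ?_
    simp only [hpolar]
    by_cases h : p ∈ T
    · rw [indicator_of_mem h, indicator_of_mem ((hmem hp).mpr h)]
    · rw [indicator_of_notMem h, indicator_of_notMem (fun h' => h ((hmem hp).mp h')), smul_zero]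
  have hintegrable : IntegrableOn (fun p : ℝ × ℝ => p.1 • f (circleMap 0 p.1 p.2)) T := by
    constructor
    · refine ContinuousOn.aestronglyMeasurable ?_ hTm
      refine continuousOn_fst.smul (hc.comp (by unfold circleMap; fun_prop) fun p hp => ?_)
      exact (hmem (hTt.symm ▸ hp : p ∈ polarCoord.target ∩ T).1).mpr hp
    · have h := hi.2
      rw [HasFiniteIntegral, ← lintegral_indicator measurableSet_ball,
        ← Complex.lintegral_comp_polarCoord_symm] at h
      refine lt_of_le_of_lt ?_ h
      rw [← hTt, ← Measure.restrict_restrict_of_subset inter_subset_left,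
        hTt]
      refine (setLIntegral_mono_ae' hTm (.of_forall fun p hp => ?_)).trans
        (lintegral_mono' Measure.restrict_le_self le_rfl)
      have hp' := (hTt.symm ▸ hp : p ∈ polarCoord.target ∩ T).1
      rw [hpolar, indicator_of_mem ((hmem hp').mpr hp), enorm_smul, smul_eq_mul,
        Real.enorm_of_nonneg hp.1.1.le]
  rw [hint, hT, Measure.volume_eq_prod, setIntegral_prod _ hintegrable,
    intervalIntegral.integral_of_le zero_le_one, integral_Ioc_eq_integral_Ioo]
  congr 1
  ext r
  rw [integral_smul, ← integral_Ioc_eq_integral_Ioo,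
    ← intervalIntegral.integral_of_le (by linarith [Real.pi_pos])]
  -- Polar coordinates use the angles `(-π, π)`; periodicity moves them to `(0, 2π)`.
  have hper : Function.Periodic (fun θ => f (circleMap 0 r θ)) (2 * Real.pi) :=
    fun θ => by simp only [periodic_circleMap 0 r θ]
  have := hper.intervalIntegral_add_eq (-Real.pi) 0
  rw [zero_add, show -Real.pi + 2 * Real.pi = Real.pi by ring] at this
  rw [this]

/-- On the circle of radius `r` one has `w̄ = r² / w`, so that Cauchy's formula for the derivative
evaluates the integral of a holomorphic function against the disc kernel. -/
theorem integral_circleMap_discKernel_mul {h : ℂ → ℂ} (hh : DifferentiableOn ℂ h (ball 0 1))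
    {z : ℂ} (hz : z ∈ ball (0 : ℂ) 1) {r : ℝ} (hr0 : 0 < r) (hr1 : r < 1) :
    ∫ θ in (0 : ℝ)..2 * Real.pi, discKernel z (circleMap 0 r θ) * h (circleMap 0 r θ) =
      2 * deriv (fun w => w * h w) (r ^ 2 * z) := by
  rw [mem_ball_zero_iff] at hz
  have hw0 : (r : ℂ) ^ 2 * z ∈ ball (0 : ℂ) r := by
    rw [mem_ball_zero_iff, norm_mul, norm_pow, Complex.norm_real, Real.norm_eq_abs,
      abs_of_pos hr0]
    nlinarith [norm_nonneg z, mul_pos hr0 hr0]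
  have key := Complex.two_pi_I_inv_smul_circleIntegral_sub_sq_inv_smul_of_differentiable
    isOpen_ball (closedBall_subset_ball hr1) (differentiableOn_id.mul hh) hw0
  have hpi : (Real.pi : ℂ) ≠ 0 := by simp [Real.pi_ne_zero]
  have hI := Complex.I_ne_zero
  change _ = 2 * deriv (id * h) _
  rw [← key, circleIntegral, smul_eq_mul, ← mul_assoc, ← intervalIntegral.integral_const_mul]
  refine intervalIntegral.integral_congr fun θ _ => ?_
  set w := circleMap 0 r θ with hw
  have hnorm : ‖w‖ = r := by rw [hw, norm_circleMap_zero, abs_of_pos hr0]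
  have hw_ne : w ≠ 0 := norm_pos_iff.mp (hnorm ▸ hr0)
  have hconj : (r : ℂ) ^ 2 = w * conj w := by rw [Complex.mul_conj', hnorm]
  have h1 : 1 - z * conj w ≠ 0 := one_sub_ne_zero_of_norm_lt_one
    (norm_mul_conj_lt_one hz (hnorm ▸ hr1))
  simp only [deriv_circleMap, ← hw, smul_eq_mul, Pi.mul_apply, id, discKernel]
  rw [show w - r ^ 2 * z = w * (1 - z * conj w) by rw [hconj]; ring]
  field_simp

/-- The radial integral in the reproducing formula: the integrand is the derivative of
`r ↦ r² h(r² z)`. -/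
theorem integral_smul_deriv_mul_self {h : ℂ → ℂ} (hh : DifferentiableOn ℂ h (ball 0 1))
    {z : ℂ} (hz : z ∈ ball (0 : ℂ) 1) :
    ∫ r in (0 : ℝ)..1, r • (2 * deriv (fun w => w * h w) ((r : ℂ) ^ 2 * z)) = h z := by
  rw [mem_ball_zero_iff] at hz
  have hmaps : ∀ r ∈ uIcc (0 : ℝ) 1, (r : ℂ) ^ 2 * z ∈ ball (0 : ℂ) 1 := by
    intro r hr
    rw [uIcc_of_le zero_le_one] at hr
    rw [mem_ball_zero_iff, norm_mul, norm_pow, Complex.norm_real, Real.norm_eq_abs,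
      abs_of_nonneg hr.1]
    have : r ^ 2 ≤ 1 := pow_le_one₀ hr.1 hr.2
    nlinarith [norm_nonneg z]
  have hderiv : ∀ r ∈ uIcc (0 : ℝ) 1, HasDerivAt (fun r : ℝ => (r : ℂ) ^ 2 * h ((r : ℂ) ^ 2 * z))
      (r • (2 * deriv (fun w => w * h w) ((r : ℂ) ^ 2 * z))) r := by
    intro r hr
    have hd := (hh.differentiableAt (isOpen_ball.mem_nhds (hmaps r hr))).hasDerivAt
    have h2 : HasDerivAt (fun x : ℂ => x ^ 2) (2 * (r : ℂ)) (r : ℂ) := by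
      simpa using hasDerivAt_pow 2 (r : ℂ)
    have h3 := (h2.mul (hd.comp (r : ℂ) (h2.mul_const z))).comp_ofReal
    have h4 := ((hasDerivAt_id _).mul hd).deriv
    change deriv (fun w => w * h w) _ = _ at h4
    rw [h4]
    refine HasDerivAt.congr_deriv h3 ?_
    simp only [Complex.real_smul, id, Function.comp]
    ring
  rw [intervalIntegral.integral_eq_sub_of_hasDerivAt hderiv]
  · simp
  · refine ContinuousOn.intervalIntegrable ?_
    have hW : DifferentiableOn ℂ (deriv fun w => w * h w) (ball 0 1) :=
      (differentiableOn_id.mul hh).deriv isOpen_ball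
    exact continuousOn_id.smul (continuousOn_const.mul (hW.continuousOn.comp (by fun_prop) hmaps))

theorem IntegrableOn.discKernel_mul {s : Set ℂ} (hs : MeasurableSet s) (hsb : s ⊆ ball 0 1)
    {h : ℂ → ℂ} (hi : IntegrableOn h s) {z : ℂ} (hz : z ∈ ball (0 : ℂ) 1) :
    IntegrableOn (fun w => discKernel z w * h w) s :=
  hi.bdd_mul (((continuousOn_discKernel hz).mono hsb).aestronglyMeasurable hs)
    ((ae_restrict_iff' hs).mpr (.of_forall fun _ hw => norm_discKernel_le hz (hsb hw)))

/-- The reproducing formula of the unit disc, valid for all integrable holomorphic functions. -/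
theorem integral_discKernel_mul {h : ℂ → ℂ} (hh : DifferentiableOn ℂ h (ball 0 1))
    (hi : IntegrableOn h (ball 0 1)) {z : ℂ} (hz : z ∈ ball (0 : ℂ) 1) :
    ∫ w in ball (0 : ℂ) 1, discKernel z w * h w = h z := by
  refine (integral_unitBall_eq_integral_circleMap
    ((continuousOn_discKernel hz).mul hh.continuousOn)
    (IntegrableOn.discKernel_mul measurableSet_ball subset_rfl hi hz)).trans ?_
  rw [← integral_smul_deriv_mul_self hh hz]
  simp only [intervalIntegral.integral_of_le (zero_le_one' ℝ), integral_Ioc_eq_integral_Ioo]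
  refine setIntegral_congr_fun measurableSet_Ioo fun r hr => ?_
  exact congrArg (r • ·) (integral_circleMap_discKernel_mul hh hz hr.1 hr.2)

/-! ### Affine changes of variables and the sub-mean value inequality -/

/-- Multiplication by `a ≠ 0` on `ℂ` has real Jacobian `|a|²`. -/
theorem enorm_sq_mul_lintegral_comp_mul_left {a : ℂ} (ha : a ≠ 0) (F : ℂ → ℝ≥0∞) :
    ‖a‖ₑ ^ 2 * ∫⁻ u, F (a * u) = ∫⁻ u, F u := by
  have hdet : LinearMap.det (LinearMap.mulLeft ℝ a) = ‖a‖ ^ 2 := by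
    have h := DFunLike.congr_fun Algebra.norm_complex_eq a
    rw [Algebra.norm_apply] at h
    exact h.trans (Complex.normSq_eq_norm_sq a)
  have hpos : 0 < ‖a‖ ^ 2 := pow_pos (norm_pos_iff.mpr ha) 2
  have hmap := Measure.map_linearMap_addHaar_eq_smul_addHaar (volume : Measure ℂ)
    (f := LinearMap.mulLeft ℝ a) (hdet ▸ hpos.ne')
  rw [hdet, abs_of_pos (inv_pos.mpr hpos)] at hmap
  have h := lintegral_map_equiv F (MeasurableEquiv.mulLeft₀ a ha) (μ := volume)
  change ∫⁻ u, F u ∂(Measure.map (LinearMap.mulLeft ℝ a) volume) = ∫⁻ u, F (a * u) at h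
  rw [← h, hmap, lintegral_smul_measure, smul_eq_mul, ← mul_assoc, ← ofReal_norm,
    ← ENNReal.ofReal_pow (norm_nonneg _), ← ENNReal.ofReal_mul hpos.le,
    mul_inv_cancel₀ hpos.ne', ENNReal.ofReal_one, one_mul]

theorem enorm_sq_mul_setLIntegral_comp_affine {a : ℂ} (ha : a ≠ 0) (c : ℂ) (F : ℂ → ℝ≥0∞) :
    ‖a‖ₑ ^ 2 * ∫⁻ u in ball 0 1, F (c + a * u) = ∫⁻ u in ball c ‖a‖, F u := by
  rw [← lintegral_indicator measurableSet_ball, ← lintegral_indicator measurableSet_ball,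
    ← lintegral_add_left_eq_self ((ball c ‖a‖).indicator F) c,
    ← enorm_sq_mul_lintegral_comp_mul_left ha fun u => (ball c ‖a‖).indicator F (c + u)]
  congr 1
  refine lintegral_congr fun u => ?_
  have : c + a * u ∈ ball c ‖a‖ ↔ u ∈ ball (0 : ℂ) 1 := by
    rw [mem_ball_iff_norm, add_sub_cancel_left, norm_mul, mem_ball_zero_iff,
      mul_lt_iff_lt_one_right (norm_pos_iff.mpr ha)]
  by_cases hu : u ∈ ball (0 : ℂ) 1
  · rw [indicator_of_mem hu, indicator_of_mem (this.mpr hu)]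
  · rw [indicator_of_notMem hu, indicator_of_notMem (fun h => hu (this.mp h))]

/-- The sub-mean value inequality for `|h|²` on a disc of radius `|a|`, with a non-optimal
constant. -/
theorem enorm_sq_mul_enorm_sq_le_setLIntegral {a c : ℂ} (ha : a ≠ 0) {h : ℂ → ℂ}
    (hh : DifferentiableOn ℂ h (ball c ‖a‖)) :
    ‖a‖ₑ ^ 2 * ‖h c‖ₑ ^ 2 ≤ ∫⁻ u in ball c ‖a‖, ‖h u‖ₑ ^ 2 := by
  rw [← enorm_sq_mul_setLIntegral_comp_affine ha c]
  gcongr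
  set k : ℂ → ℂ := fun u => h (c + a * u) ^ 2 with hk
  have hmaps : MapsTo (fun u => c + a * u) (ball (0 : ℂ) 1) (ball c ‖a‖) := by
    intro u hu
    rw [mem_ball_iff_norm, add_sub_cancel_left, norm_mul]
    exact mul_lt_of_lt_one_right (norm_pos_iff.mpr ha) (mem_ball_zero_iff.mp hu)
  have hkd : DifferentiableOn ℂ k (ball 0 1) := (hh.comp (by fun_prop) hmaps).pow 2
  have hke : ∫⁻ u in ball (0 : ℂ) 1, ‖h (c + a * u)‖ₑ ^ 2 = ∫⁻ u in ball (0 : ℂ) 1, ‖k u‖ₑ := by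
    simp only [hk, enorm_pow]
  rw [hke]
  -- The reproducing formula for `k = h ∘ (c + a ·)` squared, at the centre, has kernel `1 / π ≤ 1`.
  rcases eq_or_ne (∫⁻ u in ball (0 : ℂ) 1, ‖k u‖ₑ) ∞ with htop | htop
  · exact htop ▸ le_top
  have hki : IntegrableOn k (ball 0 1) :=
    ⟨hkd.continuousOn.aestronglyMeasurable measurableSet_ball, htop.lt_top⟩
  have h0 : (0 : ℂ) ∈ ball (0 : ℂ) 1 := mem_ball_self one_pos
  have hrep := integral_discKernel_mul hkd hki h0
  have : ‖h c‖ₑ ^ 2 = ‖k 0‖ₑ := by simp [hk]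
  rw [this, ← hrep]
  refine (enorm_integral_le_lintegral_enorm _).trans (lintegral_mono fun u => ?_)
  rw [enorm_mul]
  refine mul_le_of_le_one_left' ?_
  rw [← ofReal_norm, ENNReal.ofReal_le_one]
  simp only [discKernel, zero_mul, sub_zero, one_pow, mul_one, norm_div, norm_one,
    Complex.norm_real, Real.norm_eq_abs, abs_of_pos Real.pi_pos]
  rw [div_le_one Real.pi_pos]
  linarith [Real.pi_gt_three]

/-! ### The punctured unit disc -/

/-- The punctured unit disc. -/
def puncturedDisc : Set ℂ := ball 0 1 \ {0}

theorem isOpen_puncturedDisc : IsOpen puncturedDisc := isOpen_ball.sdiff isClosed_singleton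

theorem puncturedDisc_subset_ball : puncturedDisc ⊆ ball 0 1 := sdiff_subset

theorem restrict_puncturedDisc : volume.restrict puncturedDisc = volume.restrict (ball (0 : ℂ) 1) :=
  Measure.restrict_congr_set (sdiff_null_ae_eq_self (measure_singleton 0))

/-- A square-integrable holomorphic function on the punctured disc is `o(1 / |v|)` at the
puncture: `|v|² |h(v)|²` is at most the integral of `|h|²` over the shrinking disc of centre `v`
and radius `|v|`. -/
theorem tendsto_mul_self_of_memLp_puncturedDisc {h : ℂ → ℂ}
    (hh : DifferentiableOn ℂ h puncturedDisc) (hL : MemLp h 2 (volume.restrict puncturedDisc)) :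
    Tendsto (fun v => v * h v) (𝓝[≠] 0) (𝓝 0) := by
  have hfin : ∫⁻ u in puncturedDisc, ‖h u‖ₑ ^ 2 ≠ ∞ := by
    have := ((memLp_two_iff_integrable_sq_norm hL.1).mp hL).2
    rw [HasFiniteIntegral] at this
    simpa using this.ne
  have hvol : Tendsto (volume.restrict puncturedDisc ∘ fun v : ℂ => ball v ‖v‖) (𝓝[≠] 0) (𝓝 0) := by
    have h1 : Tendsto (fun v : ℂ => ENNReal.ofReal ‖v‖ ^ 2 * NNReal.pi) (𝓝[≠] 0) (𝓝 0) := by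
      have : Tendsto (fun v : ℂ => ENNReal.ofReal ‖v‖) (𝓝[≠] 0) (𝓝 0) := by
        have := (ENNReal.continuous_ofReal.comp (continuous_norm (E := ℂ))).tendsto 0
        rw [Function.comp_apply, norm_zero, ENNReal.ofReal_zero] at this
        exact this.mono_left nhdsWithin_le_nhds
      have h2 := ENNReal.Tendsto.mul_const (ENNReal.Tendsto.pow (n := 2) this)
        (b := (NNReal.pi : ℝ≥0∞)) (Or.inr ENNReal.coe_ne_top)
      simpa using h2
    refine tendsto_of_tendsto_of_tendsto_of_le_of_le tendsto_const_nhds h1 (fun _ => zero_le)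
      fun v => (Measure.restrict_apply_le _ _).trans ?_
    rw [Complex.volume_ball]
  have hlim := tendsto_setLIntegral_zero hfin hvol
  have hlim2 : Tendsto (fun v => ‖v * h v‖ₑ ^ 2) (𝓝[≠] 0) (𝓝 0) := by
    refine tendsto_of_tendsto_of_tendsto_of_le_of_le' tendsto_const_nhds hlim
      (.of_forall fun _ => zero_le) ?_
    have hnhds : ball (0 : ℂ) (1 / 2) ∈ 𝓝[≠] (0 : ℂ) :=
      mem_nhdsWithin_of_mem_nhds (ball_mem_nhds _ (by norm_num))
    filter_upwards [hnhds, self_mem_nhdsWithin] with v hv hv0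
    rw [mem_ball_zero_iff] at hv
    -- The puncture lies on the boundary of the open disc of centre `v` and radius `‖v‖`.
    have hsub : ball v ‖v‖ ⊆ puncturedDisc := by
      intro u hu
      rw [mem_ball_iff_norm] at hu
      refine ⟨?_, ?_⟩
      · rw [mem_ball_zero_iff]
        linarith [norm_le_insert' u v]
      · rintro rfl
        simp at hu
    rw [Measure.restrict_restrict measurableSet_ball, inter_eq_left.mpr hsub, enorm_mul, mul_pow]
    exact enorm_sq_mul_enorm_sq_le_setLIntegral hv0 (hh.mono hsub)
  have hlim3 : Tendsto (fun v => ‖v * h v‖ ^ 2) (𝓝[≠] 0) (𝓝 0) := by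
    have := (ENNReal.tendsto_toReal ENNReal.zero_ne_top).comp hlim2
    simpa [Function.comp_def] using this
  rw [tendsto_zero_iff_norm_tendsto_zero]
  simpa only [Real.sqrt_sq (norm_nonneg _), Real.sqrt_zero] using hlim3.sqrt

/-- The reproducing formula for square-integrable holomorphic functions on the punctured disc,
which extend holomorphically to the disc. -/
theorem setIntegral_puncturedDisc_discKernel_mul {h : ℂ → ℂ}
    (hh : DifferentiableOn ℂ h puncturedDisc) (hL : MemLp h 2 (volume.restrict puncturedDisc))
    {z : ℂ} (hz : z ∈ puncturedDisc) :
    ∫ w in puncturedDisc, discKernel z w * h w = h z := by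
  have hlim := tendsto_mul_self_of_memLp_puncturedDisc hh hL
  have ho : (fun v => h v - h 0) =o[𝓝[≠] 0] fun v => (v - 0)⁻¹ := by
    rw [Asymptotics.isLittleO_iff_tendsto']
    · have h1 : Tendsto (fun v : ℂ => v * h 0) (𝓝[≠] 0) (𝓝 0) := by
        have : Tendsto (fun v : ℂ => v * h 0) (𝓝 0) (𝓝 (0 * h 0)) :=
          (continuous_id.mul continuous_const).tendsto 0
        rw [zero_mul] at this
        exact this.mono_left nhdsWithin_le_nhds
      have := hlim.sub h1
      rw [sub_zero] at this
      refine this.congr fun v => ?_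
      rw [sub_zero, div_inv_eq_mul]
      ring
    · filter_upwards [self_mem_nhdsWithin] with v hv h0
      exact absurd (by simpa using h0) hv
  have hext := Complex.differentiableOn_update_limUnder_of_isLittleO
    (isOpen_ball.mem_nhds (mem_ball_self one_pos)) hh ho
  set H := Function.update h 0 (limUnder (𝓝[≠] 0) h)
  have hH : EqOn H h puncturedDisc := fun v hv => Function.update_of_ne hv.2 _ _
  have hfinite : IsFiniteMeasure (volume.restrict puncturedDisc) := by
    rw [restrict_puncturedDisc]
    exact isFiniteMeasure_restrict.mpr measure_ball_lt_top.ne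
  have hHi : IntegrableOn H (ball 0 1) := by
    rw [IntegrableOn, ← restrict_puncturedDisc]
    exact (IntegrableOn.congr_fun (hL.integrable one_le_two) hH.symm
      isOpen_puncturedDisc.measurableSet)
  rw [← hH hz, ← integral_discKernel_mul hext hHi (puncturedDisc_subset_ball hz),
    ← restrict_puncturedDisc]
  refine setIntegral_congr_fun isOpen_puncturedDisc.measurableSet fun v hv => ?_
  simp only [hH hv]

/-! ### The product of the disc and the punctured disc -/

/-- The product of the unit disc and the punctured unit disc. -/
def puncturedBidisc : Set (ℂ × ℂ) := ball 0 1 ×ˢ puncturedDisc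

theorem isOpen_puncturedBidisc : IsOpen puncturedBidisc := isOpen_ball.prod isOpen_puncturedDisc

theorem restrict_puncturedBidisc : volume.restrict puncturedBidisc =
    (volume.restrict (ball (0 : ℂ) 1)).prod (volume.restrict puncturedDisc) := by
  rw [Measure.prod_restrict]
  rfl

instance isFiniteMeasure_restrict_unitBall :
    IsFiniteMeasure (volume.restrict (ball (0 : ℂ) 1)) :=
  isFiniteMeasure_restrict.mpr measure_ball_lt_top.ne

instance isFiniteMeasure_restrict_puncturedDisc :
    IsFiniteMeasure (volume.restrict puncturedDisc) :=
  restrict_puncturedDisc ▸ inferInstance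

instance isFiniteMeasure_restrict_puncturedBidisc :
    IsFiniteMeasure (volume.restrict puncturedBidisc) :=
  restrict_puncturedBidisc ▸ inferInstance

/-- For a square-integrable holomorphic function on the punctured bidisc, almost every slice in the
disc variable is square-integrable. -/
theorem ae_memLp_slice_fst {g : ℂ × ℂ → ℂ} (hg : DifferentiableOn ℂ g puncturedBidisc)
    (hL : MemLp g 2 (volume.restrict puncturedBidisc)) :
    ∀ᵐ v ∂volume.restrict puncturedDisc, DifferentiableOn ℂ (fun u => g (u, v)) (ball 0 1) ∧
      MemLp (fun u => g (u, v)) 2 (volume.restrict (ball 0 1)) := by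
  have hsq := (memLp_two_iff_integrable_sq_norm hL.1).mp hL
  rw [restrict_puncturedBidisc] at hsq
  filter_upwards [hsq.prod_left_ae,
    ae_restrict_mem isOpen_puncturedDisc.measurableSet] with v hv hvP
  have hd : DifferentiableOn ℂ (fun u => g (u, v)) (ball 0 1) :=
    hg.comp (by fun_prop) fun u hu => ⟨hu, hvP⟩
  exact ⟨hd, (memLp_two_iff_integrable_sq_norm
    (hd.continuousOn.aestronglyMeasurable measurableSet_ball)).mpr hv⟩

/-- For a square-integrable holomorphic function on the punctured bidisc, every slice in the
punctured variable is square-integrable: the reproducing formula for the square of the other slices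
bounds `|g(z, v)|²` by a multiple of `∫ |g(u, v)|² du`. -/
theorem memLp_slice_snd {g : ℂ × ℂ → ℂ} (hg : DifferentiableOn ℂ g puncturedBidisc)
    (hL : MemLp g 2 (volume.restrict puncturedBidisc)) {z : ℂ} (hz : z ∈ ball (0 : ℂ) 1) :
    DifferentiableOn ℂ (fun v => g (z, v)) puncturedDisc ∧
      MemLp (fun v => g (z, v)) 2 (volume.restrict puncturedDisc) := by
  have hd : DifferentiableOn ℂ (fun v => g (z, v)) puncturedDisc :=
    hg.comp (by fun_prop) fun v hv => ⟨hz, hv⟩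
  have hm := hd.continuousOn.aestronglyMeasurable (μ := volume) isOpen_puncturedDisc.measurableSet
  refine ⟨hd, (memLp_two_iff_integrable_sq_norm hm).mpr ?_⟩
  have hsq := (memLp_two_iff_integrable_sq_norm hL.1).mp hL
  rw [restrict_puncturedBidisc] at hsq
  refine (hsq.integral_prod_right.const_mul (1 / (Real.pi * (1 - ‖z‖) ^ 2))).mono'
    (hm.norm.pow 2) ?_
  filter_upwards [ae_memLp_slice_fst hg hL] with v hv
  have hsqv := (memLp_two_iff_integrable_sq_norm hv.2.1).mp hv.2
  have hrep := integral_discKernel_mul (hv.1.pow 2) (h := fun u => g (u, v) ^ 2)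
    ⟨(hv.1.pow 2).continuousOn.aestronglyMeasurable measurableSet_ball,
      hsqv.2.mono (.of_forall fun u => by simp)⟩ hz
  rw [Real.norm_eq_abs, abs_of_nonneg (by positivity), ← norm_pow, ← hrep,
    ← integral_const_mul]
  refine norm_integral_le_of_norm_le (hsqv.const_mul _) ?_
  filter_upwards [ae_restrict_mem measurableSet_ball] with u hu
  rw [norm_mul, norm_pow]
  exact mul_le_mul_of_nonneg_right (norm_discKernel_le hz hu) (by positivity)

/-- The product of two disc kernels reproduces the square-integrable holomorphic functions on the
punctured bidisc. -/
theorem setIntegral_puncturedBidisc_mul {g : ℂ × ℂ → ℂ}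
    (hg : DifferentiableOn ℂ g puncturedBidisc)
    (hL : MemLp g 2 (volume.restrict puncturedBidisc)) {z : ℂ × ℂ} (hz : z ∈ puncturedBidisc) :
    ∫ p in puncturedBidisc, discKernel z.1 p.1 * discKernel z.2 p.2 * g p = g z := by
  have hz2 := puncturedDisc_subset_ball hz.2
  have hint : IntegrableOn (fun p => discKernel z.1 p.1 * discKernel z.2 p.2 * g p)
      puncturedBidisc := by
    refine (hL.integrable one_le_two).bdd_mul
      (c := 1 / (Real.pi * (1 - ‖z.1‖) ^ 2) * (1 / (Real.pi * (1 - ‖z.2‖) ^ 2))) ?_ ?_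
    · refine ContinuousOn.aestronglyMeasurable ?_ isOpen_puncturedBidisc.measurableSet
      exact ((continuousOn_discKernel hz.1).comp continuousOn_fst fun p hp => hp.1).mul
        ((continuousOn_discKernel hz2).comp continuousOn_snd
          fun p hp => puncturedDisc_subset_ball hp.2)
    · filter_upwards [ae_restrict_mem isOpen_puncturedBidisc.measurableSet] with p hp
      rw [norm_mul]
      exact mul_le_mul (norm_discKernel_le hz.1 hp.1)
        (norm_discKernel_le hz2 (puncturedDisc_subset_ball hp.2)) (norm_nonneg _) (by positivity)
  rw [IntegrableOn, restrict_puncturedBidisc] at hint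
  obtain ⟨hd, hm⟩ := memLp_slice_snd hg hL hz.1
  have hrep := setIntegral_puncturedDisc_discKernel_mul hd hm hz.2
  rw [restrict_puncturedBidisc, integral_prod_symm _ hint]
  refine Eq.trans (integral_congr_ae ?_) hrep
  filter_upwards [ae_memLp_slice_fst hg hL] with v hv
  rw [← integral_discKernel_mul hv.1 (hv.2.integrable one_le_two) hz.1, ← integral_const_mul]
  congr 1
  ext u
  ring

/-! ### The Hartogs triangle as an image of the punctured bidisc -/

theorem mem_hartogsTriangle_one_div_iff {k : ℕ} (hk : 0 < k) {z : ℂ × ℂ} :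
    z ∈ hartogsTriangle (1 / (k : ℝ)) ↔ ‖z.1‖ < ‖z.2‖ ^ k ∧ ‖z.2‖ < 1 := by
  rw [hartogsTriangle, mem_ofPred_eq, one_div,
    Real.rpow_inv_lt_iff_of_pos (norm_nonneg _) (norm_nonneg _) (by exact_mod_cast hk),
    Real.rpow_natCast]

theorem isOpen_hartogsTriangle_one_div {k : ℕ} (hk : 0 < k) :
    IsOpen (hartogsTriangle (1 / (k : ℝ))) := by
  have : hartogsTriangle (1 / (k : ℝ)) = {z | ‖z.1‖ < ‖z.2‖ ^ k} ∩ {z | ‖z.2‖ < 1} :=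
    ext fun z => mem_hartogsTriangle_one_div_iff hk
  rw [this]
  exact (isOpen_lt (by fun_prop) (by fun_prop)).inter (isOpen_lt (by fun_prop) (by fun_prop))

theorem snd_ne_zero_of_mem_hartogsTriangle {k : ℕ} (hk : 0 < k) {z : ℂ × ℂ}
    (hz : z ∈ hartogsTriangle (1 / (k : ℝ))) : z.2 ≠ 0 := by
  intro h
  have := ((mem_hartogsTriangle_one_div_iff hk).mp hz).1
  rw [h, norm_zero, zero_pow hk.ne'] at this
  exact (norm_nonneg _).not_gt this

/-- The map `(u, v) ↦ (u vᵏ, v)`, which carries the punctured bidisc biholomorphically onto the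
Hartogs triangle of exponent `1 / k`. Its complex Jacobian is `vᵏ`. -/
def hartogsMap (k : ℕ) (p : ℂ × ℂ) : ℂ × ℂ := (p.1 * p.2 ^ k, p.2)

theorem differentiable_hartogsMap (k : ℕ) : Differentiable ℂ (hartogsMap k) := by
  unfold hartogsMap
  fun_prop

theorem mapsTo_hartogsMap {k : ℕ} (hk : 0 < k) :
    MapsTo (hartogsMap k) puncturedBidisc (hartogsTriangle (1 / (k : ℝ))) := by
  intro p hp
  refine (mem_hartogsTriangle_one_div_iff hk).mpr ⟨?_, mem_ball_zero_iff.mp hp.2.1⟩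
  simp only [hartogsMap, norm_mul, norm_pow]
  exact mul_lt_of_lt_one_left (pow_pos (norm_pos_iff.mpr hp.2.2) k) (mem_ball_zero_iff.mp hp.1)

/-- Change of variables for `(u, v) ↦ (u vᵏ, v)`: by Tonelli it reduces to the linear change of
variables `u ↦ u vᵏ` in each slice. -/
theorem map_hartogsMap_withDensity {k : ℕ} (hk : 0 < k) :
    ((volume.restrict puncturedBidisc).withDensity fun p => ‖p.2 ^ k‖ₑ ^ 2).map (hartogsMap k) =
      volume.restrict (hartogsTriangle (1 / (k : ℝ))) := by
  have hmeas := (differentiable_hartogsMap k).continuous.measurable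
  have hdens : Measurable fun p : ℂ × ℂ => ‖p.2 ^ k‖ₑ ^ 2 := by fun_prop
  have hH := (isOpen_hartogsTriangle_one_div hk).measurableSet
  refine Measure.ext_of_lintegral _ fun f hf => ?_
  have hfm : Measurable fun p => f (hartogsMap k p) := hf.comp hmeas
  rw [lintegral_map hf hmeas,
    lintegral_withDensity_eq_lintegral_mul _ hdens hfm, restrict_puncturedBidisc,
    lintegral_prod_symm _ (hdens.mul hfm).aemeasurable, ← lintegral_indicator hH,
    Measure.volume_eq_prod, lintegral_prod_symm _ (hf.indicator hH).aemeasurable,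
    ← lintegral_indicator isOpen_puncturedDisc.measurableSet]
  refine lintegral_congr fun v => ?_
  by_cases hv : v ∈ puncturedDisc
  · have hvk : v ^ k ≠ 0 := pow_ne_zero k hv.2
    have h := enorm_sq_mul_setLIntegral_comp_affine hvk 0 fun u => f (u, v)
    rw [indicator_of_mem hv]
    have hslice : ∀ u, (hartogsTriangle (1 / (k : ℝ))).indicator f (u, v) =
        (ball (0 : ℂ) ‖v ^ k‖).indicator (fun u => f (u, v)) u := by
      intro u
      have : (u, v) ∈ hartogsTriangle (1 / (k : ℝ)) ↔ u ∈ ball (0 : ℂ) ‖v ^ k‖ := by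
        rw [mem_hartogsTriangle_one_div_iff hk, mem_ball_zero_iff, norm_pow]
        exact and_iff_left (mem_ball_zero_iff.mp hv.1)
      by_cases hu : u ∈ ball (0 : ℂ) ‖v ^ k‖
      · rw [indicator_of_mem hu, indicator_of_mem (this.mpr hu)]
      · rw [indicator_of_notMem hu, indicator_of_notMem fun h => hu (this.mp h)]
    simp only [hslice]
    rw [lintegral_indicator measurableSet_ball, ← h, ← lintegral_const_mul _ (by fun_prop)]
    refine lintegral_congr fun u => ?_
    simp only [Pi.mul_apply, hartogsMap, zero_add, mul_comm u]
  · rw [indicator_of_notMem hv]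
    have hzero : ∀ u, (hartogsTriangle (1 / (k : ℝ))).indicator f (u, v) = 0 := fun u =>
      indicator_of_notMem (fun h => hv ⟨mem_ball_zero_iff.mpr
        ((mem_hartogsTriangle_one_div_iff hk).mp h).2,
        snd_ne_zero_of_mem_hartogsTriangle (z := (u, v)) hk h⟩) f
    simp only [hzero, lintegral_zero]

theorem setIntegral_hartogsTriangle_eq {k : ℕ} (hk : 0 < k) {F : ℂ × ℂ → ℂ}
    (hF : ContinuousOn F (hartogsTriangle (1 / (k : ℝ)))) :
    ∫ w in hartogsTriangle (1 / (k : ℝ)), F w =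
      ∫ p in puncturedBidisc, (‖p.2 ^ k‖ ^ 2) • F (hartogsMap k p) := by
  have hm := hF.aestronglyMeasurable (μ := volume) (isOpen_hartogsTriangle_one_div hk).measurableSet
  rw [← map_hartogsMap_withDensity hk] at hm ⊢
  rw [integral_map (differentiable_hartogsMap k).continuous.aemeasurable hm,
    integral_withDensity_eq_integral_toReal_smul (by fun_prop)
      (.of_forall fun p => by finiteness)]
  simp

theorem integrableOn_hartogsTriangle_iff {k : ℕ} (hk : 0 < k) {F : ℂ × ℂ → ℝ}
    (hF : ContinuousOn F (hartogsTriangle (1 / (k : ℝ)))) :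
    IntegrableOn F (hartogsTriangle (1 / (k : ℝ))) ↔
      IntegrableOn (fun p => (‖p.2 ^ k‖ ^ 2) • F (hartogsMap k p)) puncturedBidisc := by
  have hm := hF.aestronglyMeasurable (μ := volume) (isOpen_hartogsTriangle_one_div hk).measurableSet
  rw [IntegrableOn]
  rw [← map_hartogsMap_withDensity hk] at hm ⊢
  rw [integrable_map_measure hm (differentiable_hartogsMap k).continuous.aemeasurable,
    integrable_withDensity_iff_integrable_smul' (by fun_prop)
      (.of_forall fun p => by finiteness)]
  simp [IntegrableOn]

/-- The pull-back `g(u, v) = vᵏ f(u vᵏ, v)` preserves square-integrability. -/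
theorem memLp_hartogsTriangle_iff {k : ℕ} (hk : 0 < k) {f : ℂ × ℂ → ℂ}
    (hf : ContinuousOn f (hartogsTriangle (1 / (k : ℝ)))) :
    MemLp f 2 (volume.restrict (hartogsTriangle (1 / (k : ℝ)))) ↔
      MemLp (fun p => p.2 ^ k * f (hartogsMap k p)) 2 (volume.restrict puncturedBidisc) := by
  have hm := hf.aestronglyMeasurable (μ := volume) (isOpen_hartogsTriangle_one_div hk).measurableSet
  have hg : ContinuousOn (fun p : ℂ × ℂ => p.2 ^ k * f (hartogsMap k p)) puncturedBidisc :=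
    ContinuousOn.mul (by fun_prop)
      (hf.comp (differentiable_hartogsMap k).continuous.continuousOn (mapsTo_hartogsMap hk))
  rw [memLp_two_iff_integrable_sq_norm hm, memLp_two_iff_integrable_sq_norm
    (hg.aestronglyMeasurable isOpen_puncturedBidisc.measurableSet)]
  refine (integrableOn_hartogsTriangle_iff hk (hf.norm.pow 2)).trans ?_
  simp only [Pi.pow_apply, norm_mul, mul_pow, smul_eq_mul, IntegrableOn]

/-! ### The kernel of the Hartogs triangle -/

/-- The explicit kernel of the Hartogs triangle of exponent `1 / k`. -/
noncomputable def hartogsKernel (k : ℕ) (z w : ℂ × ℂ) : ℂ :=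
  (z.2 * conj w.2) ^ k /
    ((Real.pi : ℂ) ^ 2 * (1 - z.2 * conj w.2) ^ 2 *
      ((z.2 * conj w.2) ^ k - z.1 * conj w.1) ^ 2)

theorem hartogsKernel_conj_symm (k : ℕ) (z w : ℂ × ℂ) :
    hartogsKernel k w z = conj (hartogsKernel k z w) := by
  simp only [hartogsKernel, map_div₀, map_mul, map_pow, map_sub, map_one, Complex.conj_conj,
    Complex.conj_ofReal]
  rw [mul_comm w.2, mul_comm w.1]

theorem hartogsKernel_denom_ne_zero {k : ℕ} (hk : 0 < k) {z w : ℂ × ℂ}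
    (hz : z ∈ hartogsTriangle (1 / (k : ℝ))) (hw : w ∈ hartogsTriangle (1 / (k : ℝ))) :
    (Real.pi : ℂ) ^ 2 * (1 - z.2 * conj w.2) ^ 2 *
      ((z.2 * conj w.2) ^ k - z.1 * conj w.1) ^ 2 ≠ 0 := by
  rw [mem_hartogsTriangle_one_div_iff hk] at hz hw
  refine mul_ne_zero (mul_ne_zero (by simp [Real.pi_ne_zero]) (pow_ne_zero 2
    (one_sub_ne_zero_of_norm_lt_one (norm_mul_conj_lt_one hz.2 hw.2)))) (pow_ne_zero 2 ?_)
  intro h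
  have h1 : ‖z.1‖ * ‖w.1‖ < ‖z.2‖ ^ k * ‖w.2‖ ^ k :=
    mul_lt_mul'' hz.1 hw.1 (norm_nonneg _) (norm_nonneg _)
  have h2 := congrArg norm (sub_eq_zero.mp h)
  rw [norm_pow, norm_mul, norm_mul, RCLike.norm_conj, RCLike.norm_conj, mul_pow] at h2
  exact h1.ne' h2

/-- The transformation rule relating the kernel of the Hartogs triangle to that of the bidisc. -/
theorem hartogsKernel_hartogsMap (k : ℕ) {p q : ℂ × ℂ} (hp : p ∈ puncturedBidisc)
    (hq : q ∈ puncturedBidisc) :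
    p.2 ^ k * hartogsKernel k (hartogsMap k p) (hartogsMap k q) * conj (q.2 ^ k) =
      discKernel p.1 q.1 * discKernel p.2 q.2 := by
  have hpi : (Real.pi : ℂ) ≠ 0 := by simp [Real.pi_ne_zero]
  have h1 := one_sub_ne_zero_of_norm_lt_one
    (norm_mul_conj_lt_one (mem_ball_zero_iff.mp hp.1) (mem_ball_zero_iff.mp hq.1))
  have h2 := one_sub_ne_zero_of_norm_lt_one
    (norm_mul_conj_lt_one (mem_ball_zero_iff.mp hp.2.1) (mem_ball_zero_iff.mp hq.2.1))
  have hp2 : p.2 ≠ 0 := hp.2.2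
  have hq2 : conj q.2 ≠ 0 := (map_ne_zero _).mpr hq.2.2
  simp only [hartogsKernel, hartogsMap, discKernel, map_mul, map_pow, mul_pow (p.2)]
  field_simp

theorem exists_hartogsMap_eq {k : ℕ} (hk : 0 < k) {z : ℂ × ℂ}
    (hz : z ∈ hartogsTriangle (1 / (k : ℝ))) : ∃ p ∈ puncturedBidisc, hartogsMap k p = z := by
  have h2 := snd_ne_zero_of_mem_hartogsTriangle hk hz
  rw [mem_hartogsTriangle_one_div_iff hk] at hz
  refine ⟨(z.1 / z.2 ^ k, z.2), ⟨?_, mem_ball_zero_iff.mpr hz.2, h2⟩, ?_⟩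
  · rw [mem_ball_zero_iff, norm_div, norm_pow, div_lt_one (pow_pos (norm_pos_iff.mpr h2) k)]
    exact hz.1
  · rw [hartogsMap, div_mul_cancel₀ _ (pow_ne_zero k h2)]

theorem differentiableOn_hartogsKernel {k : ℕ} (hk : 0 < k) {w : ℂ × ℂ}
    (hw : w ∈ hartogsTriangle (1 / (k : ℝ))) :
    DifferentiableOn ℂ (fun z => hartogsKernel k z w) (hartogsTriangle (1 / (k : ℝ))) :=
  DifferentiableOn.mul (by fun_prop) (DifferentiableOn.inv (by fun_prop) fun _ hz =>
    hartogsKernel_denom_ne_zero hk hz hw)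

theorem hartogsKernel_mem_bergmanSpace {k : ℕ} (hk : 0 < k) {w : ℂ × ℂ}
    (hw : w ∈ hartogsTriangle (1 / (k : ℝ))) :
    (fun z => hartogsKernel k z w) ∈ bergmanSpace (hartogsTriangle (1 / (k : ℝ))) := by
  have hd := differentiableOn_hartogsKernel hk hw
  refine ⟨hd, (memLp_hartogsTriangle_iff hk hd.continuousOn).mpr ?_⟩
  have hg : ContinuousOn (fun p : ℂ × ℂ => p.2 ^ k * hartogsKernel k (hartogsMap k p) w)
      puncturedBidisc := ContinuousOn.mul (by fun_prop) (hd.continuousOn.comp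
        (differentiable_hartogsMap k).continuous.continuousOn (mapsTo_hartogsMap hk))
  obtain ⟨q, hq, rfl⟩ := exists_hartogsMap_eq hk hw
  have hq2 : 0 < ‖q.2‖ ^ k := pow_pos (norm_pos_iff.mpr hq.2.2) k
  refine MemLp.of_bound (hg.aestronglyMeasurable isOpen_puncturedBidisc.measurableSet)
    (1 / (Real.pi * (1 - ‖q.1‖) ^ 2) * (1 / (Real.pi * (1 - ‖q.2‖) ^ 2)) / ‖q.2‖ ^ k) ?_
  filter_upwards [ae_restrict_mem isOpen_puncturedBidisc.measurableSet] with p hp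
  have hsymm (a b : ℂ) : ‖discKernel a b‖ = ‖discKernel b a‖ := by
    rw [← RCLike.norm_conj (discKernel b a)]
    simp [discKernel, mul_comm]
  have h := congrArg norm (hartogsKernel_hartogsMap k hp hq)
  rw [norm_mul, RCLike.norm_conj, norm_pow q.2, norm_mul (discKernel _ _), hsymm p.1,
    hsymm p.2] at h
  rw [le_div_iff₀ hq2, h]
  exact mul_le_mul (norm_discKernel_le hq.1 hp.1) (norm_discKernel_le
    (puncturedDisc_subset_ball hq.2) (puncturedDisc_subset_ball hp.2)) (norm_nonneg _)
    (by positivity)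

theorem setIntegral_hartogsKernel_mul {k : ℕ} (hk : 0 < k) {f : ℂ × ℂ → ℂ}
    (hf : f ∈ bergmanSpace (hartogsTriangle (1 / (k : ℝ)))) {z : ℂ × ℂ}
    (hz : z ∈ hartogsTriangle (1 / (k : ℝ))) :
    ∫ w in hartogsTriangle (1 / (k : ℝ)), hartogsKernel k z w * f w = f z := by
  have hc : ContinuousOn (fun w => hartogsKernel k z w * f w)
      (hartogsTriangle (1 / (k : ℝ))) := by
    refine ContinuousOn.mul ?_ hf.1.continuousOn
    exact (Complex.continuous_conj.comp_continuousOn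
      (differentiableOn_hartogsKernel hk hz).continuousOn).congr
        fun w _ => hartogsKernel_conj_symm k w z
  obtain ⟨p, hp, rfl⟩ := exists_hartogsMap_eq hk hz
  have hpk : p.2 ^ k ≠ 0 := pow_ne_zero k hp.2.2
  have hgd : DifferentiableOn ℂ (fun p : ℂ × ℂ => p.2 ^ k * f (hartogsMap k p)) puncturedBidisc :=
    DifferentiableOn.mul (by fun_prop)
      (hf.1.comp (differentiable_hartogsMap k).differentiableOn (mapsTo_hartogsMap hk))
  have hrep := setIntegral_puncturedBidisc_mul hgd
    ((memLp_hartogsTriangle_iff hk hf.1.continuousOn).mp hf.2) hp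
  rw [setIntegral_hartogsTriangle_eq hk hc]
  refine mul_left_cancel₀ hpk (Eq.trans ?_ hrep)
  rw [← integral_const_mul]
  refine setIntegral_congr_fun isOpen_puncturedBidisc.measurableSet fun q hq => ?_
  simp only [← hartogsKernel_hartogsMap k hp hq, Complex.real_smul, Complex.ofReal_pow]
  rw [← Complex.mul_conj']
  ring

/-- A Bergman kernel is unique: both `K(z, w)` and `L(z, w)` equal `∫ L(z, x) K(x, w) dx`, the first
because `L` reproduces `K(·, w)`, the second because `K` reproduces `L(·, z)`. -/
theorem IsBergmanKernel.eqOn {Ω : Set (ℂ × ℂ)} {K L : ℂ × ℂ → ℂ × ℂ → ℂ}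
    (hΩ : MeasurableSet Ω) (hK : IsBergmanKernel Ω K) (hL : IsBergmanKernel Ω L)
    {z w : ℂ × ℂ} (hz : z ∈ Ω) (hw : w ∈ Ω) : K z w = L z w := by
  rw [hL.conj_symm w hw z hz, hL.reproducing _ (hK.mem_bergmanSpace w hw) z hz,
    hK.reproducing _ (hL.mem_bergmanSpace z hz) w hw, ← integral_conj]
  refine setIntegral_congr_fun hΩ fun x hx => ?_
  simp only [map_mul]
  rw [← hL.conj_symm x hx z hz, ← hK.conj_symm w hw x hx, mul_comm]

theorem isBergmanKernel_hartogsKernel {k : ℕ} (hk : 0 < k) :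
    IsBergmanKernel (hartogsTriangle (1 / (k : ℝ))) (hartogsKernel k) where
  mem_bergmanSpace _ hw := hartogsKernel_mem_bergmanSpace hk hw
  conj_symm z _ w _ := hartogsKernel_conj_symm k z w
  reproducing _ hf _ hz := (setIntegral_hartogsKernel_mul hk hf hz).symm

end

theorem theorem1p2 (k : ℕ) (hk : 0 < k) :
    IsBergmanKernel (hartogsTriangle (1 / (k : ℝ)))
      (fun z w =>
        (z.2 * conj w.2) ^ k /
          ((Real.pi : ℂ) ^ 2 * (1 - z.2 * conj w.2) ^ 2 *
            ((z.2 * conj w.2) ^ k - z.1 * conj w.1) ^ 2)) ∧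
    ∀ K : ℂ × ℂ → ℂ × ℂ → ℂ, IsBergmanKernel (hartogsTriangle (1 / (k : ℝ))) K →
      ∀ z ∈ hartogsTriangle (1 / (k : ℝ)), ∀ w ∈ hartogsTriangle (1 / (k : ℝ)),
        K z w =
          (z.2 * conj w.2) ^ k /
            ((Real.pi : ℂ) ^ 2 * (1 - z.2 * conj w.2) ^ 2 *
              ((z.2 * conj w.2) ^ k - z.1 * conj w.1) ^ 2) := by
  refine ⟨isBergmanKernel_hartogsKernel hk, fun K hK z hz w hw => ?_⟩
  exact hK.eqOn (isOpen_hartogsTriangle_one_div hk).measurableSet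
    (isBergmanKernel_hartogsKernel hk) hz hw
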